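/- Let $E$ be a complex Banach space and let $L$ be a finite-dimensional complex Lie algebra acting on $E$ on the right by bounded operators, i.e. there is given a Lie algebra homomorphism $\rho$ from $L$ to the algebra $\mathcal L(E)$ of bounded operators with the opposite product (for instance, $L$ is a Lie subalgebra of $\mathcal L(E)^{op}$); write $e\cdot x=\rho(x)e$ and let $\|x\|$ be the operator norm of $\rho(x)$. For a character $f$ of $L$ (that is, $f\in L^*$ with $f([L,L])=0$) consider the complex $(E\otimes\bigwedge^p L,\ d(f))_{p\ge 0}$ with $$d(f)(e\otimes x_1\wedge\dots\wedge x_p)=\sum_{k}(-1)^{k+1}\,(e\cdot x_k-f(x_k)e)\otimes x_1\wedge\dots\wedge\hat x_k\wedge\dots\wedge x_p+\sum_{k<l}(-1)^{k+l}\,e\otimes[x_k,x_l]\wedge x_1\wedge\dots\wedge\hat x_k\wedge\dots\wedge\hat x_l\wedge\dots\wedge x_p ,$$ whose homology is $H_*(L,E\otimes\mathbb C(f))$, and let $Sp(L,E)\subseteq L^*$ be the set of all characters $f$ of $L$ for which this homology is non-zero. (1) If $L$ is nilpotent, then every $f\in Sp(L,E)$ satisfies $|f(x)|\le\|x\|$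 for all $x\in L$. (2) This fails for solvable, non-nilpotent $L$: let $E=\mathbb C^2$ with the Euclidean norm, $a=\begin{pmatrix}0&\frac12\\ \frac12&0\end{pmatrix}$, $b=\begin{pmatrix}1&1\\-1&-1\end{pmatrix}$. Then $L=\mathbb Ca\oplus\mathbb Cb$ is a Lie subalgebra of $\mathcal L(E)^{op}$ which is solvable and not nilpotent, and there are $f\in Sp(L,E)$ and $x\in L$ with $|f(x)|>\|x\|$. -/

import Mathlib

open scoped TensorProduct

attribute [local instance 100] LieRing.ofAssociativeRing

noncomputable section

namespace LieSpectrum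

section Complex

variable {L : Type*} [LieRing L] [LieAlgebra ℂ L]
variable {E : Type*} [NormedAddCommGroup E] [NormedSpace ℂ E]

/-- The space `E ⊗ ⋀ᵖ L` of `p`-chains. -/
abbrev Chain (E : Type*) [NormedAddCommGroup E] [NormedSpace ℂ E]
    (L : Type*) [LieRing L] [LieAlgebra ℂ L] (p : ℕ) : Type _ :=
  E ⊗[ℂ] (⋀[ℂ]^p L)

/-- The operator `e ↦ e · x - f x • e` on `E`, as a linear function of `x`. The right action of
`L` on `E` is given by `ρ`, with values in the bounded operators with the opposite product:
`e · x = (ρ x).unop e`. -/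
def shiftedAction (ρ : L →ₗ⁅ℂ⁆ (E →L[ℂ] E)ᵐᵒᵖ) (f : Module.Dual ℂ L) : L →ₗ[ℂ] E →ₗ[ℂ] E where
  toFun x := ((ρ x).unop : E →ₗ[ℂ] E) - f x • LinearMap.id
  map_add' x y := by
    ext e
    simp only [map_add, MulOpposite.unop_add, ContinuousLinearMap.toLinearMap_add,
      LinearMap.sub_apply, LinearMap.add_apply, LinearMap.smul_apply, LinearMap.id_apply, add_smul]
    abel
  map_smul' c x := by
    ext e
    simp [mul_smul, smul_sub]

theorem shiftedAction_apply (ρ : L →ₗ⁅ℂ⁆ (E →L[ℂ] E)ᵐᵒᵖ) (f : Module.Dual ℂ L) (x : L) (e : E) :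
    shiftedAction ρ f x e = (ρ x).unop e - f x • e := rfl

/-- The first part of the differential,
`e ⊗ x₀ ∧ ⋯ ∧ xₚ ↦ ∑ₖ (-1)ᵏ (e · xₖ - f xₖ • e) ⊗ x₀ ∧ ⋯ x̂ₖ ⋯ ∧ xₚ`. -/
def actionPart (ρ : L →ₗ⁅ℂ⁆ (E →L[ℂ] E)ᵐᵒᵖ) (f : Module.Dual ℂ L) (p : ℕ) :
    Chain E L (p + 1) →ₗ[ℂ] Chain E L p :=
  TensorProduct.lift <| LinearMap.flip <| exteriorPower.alternatingMapLinearEquiv <|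
    AlternatingMap.alternatizeUncurryFin (N := E →ₗ[ℂ] Chain E L p)
      { toFun := fun x =>
          ((LinearMap.lcomp ℂ (Chain E L p) (shiftedAction ρ f x)) ∘ₗ
            (TensorProduct.mk ℂ E (⋀[ℂ]^p L)).flip).compAlternatingMap (exteriorPower.ιMulti ℂ p)
        map_add' := fun x y => by ext v e; simp
        map_smul' := fun c x => by ext v e; simp [TensorProduct.smul_tmul'] }

theorem actionPart_tmul_ιMulti (ρ : L →ₗ⁅ℂ⁆ (E →L[ℂ] E)ᵐᵒᵖ) (f : Module.Dual ℂ L) (p : ℕ)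
    (e : E) (v : Fin (p + 1) → L) :
    actionPart ρ f p (e ⊗ₜ exteriorPower.ιMulti ℂ (p + 1) v) =
      ∑ k : Fin (p + 1), (-1 : ℤ) ^ (k : ℕ) •
        (((ρ (v k)).unop e - f (v k) • e) ⊗ₜ[ℂ] exteriorPower.ιMulti ℂ p (k.removeNth v)) := by
  simp [actionPart, AlternatingMap.alternatizeUncurryFin_apply, LinearMap.sum_apply,
    shiftedAction_apply, TensorProduct.sub_tmul, TensorProduct.smul_tmul']

/-- The map `⋀^(q+2) L → ⋀^(q+1) L`,
`x₀ ∧ ⋯ ∧ x_{q+1} ↦ ∑_{k<l} (-1)^(k+l) ⁅xₖ, xₗ⁆ ∧ x₀ ∧ ⋯ x̂ₖ ⋯ x̂ₗ ⋯ ∧ x_{q+1}`.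
The iterated alternating sum below runs over all ordered pairs `k ≠ l`, hence counts each
term twice (with the opposite sign); this is the reason for the factor `-1/2`. -/
def bracketMap (L : Type*) [LieRing L] [LieAlgebra ℂ L] (q : ℕ) :
    (⋀[ℂ]^(q + 2) L) →ₗ[ℂ] (⋀[ℂ]^(q + 1) L) :=
  exteriorPower.alternatingMapLinearEquiv <| (-(1 / 2) : ℂ) •
    AlternatingMap.alternatizeUncurryFin (AlternatingMap.alternatizeUncurryFinLM ∘ₗ
      (LinearMap.llcomp ℂ L L (L [⋀^Fin q]→ₗ[ℂ] ⋀[ℂ]^(q + 1) L)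
        (exteriorPower.ιMulti ℂ (q + 1)).curryLeft) ∘ₗ
          (LieModule.toEnd ℂ L L : L →ₗ[ℂ] Module.End ℂ L))

/-- The closed formula for `bracketMap`. The pairs `k < l` of indices in `Fin (q + 2)` are
`k = i.castSucc`, `l = j.succ` with `i ≤ j`, so that `(-1)^(k+l) = (-1)^(i+j+1)`, and removing
the `j`-th entry after the `k`-th one removes the original entry with index `l`. -/
theorem bracketMap_ιMulti (q : ℕ) (v : Fin (q + 2) → L) :
    bracketMap L q (exteriorPower.ιMulti ℂ (q + 2) v) =
      ∑ i : Fin (q + 1), ∑ j ≥ i, (-1 : ℤ) ^ (i + j + 1 : ℕ) •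
        exteriorPower.ιMulti ℂ (q + 1)
          (Matrix.vecCons ⁅v i.castSucc, v j.succ⁆ (j.removeNth (i.castSucc.removeNth v))) := by
  rw [bracketMap, exteriorPower.alternatingMapLinearEquiv_apply_ιMulti, AlternatingMap.smul_apply,
    AlternatingMap.alternatizeUncurryFin_alternatizeUncurryFinLM_comp_apply, Finset.smul_sum]
  refine Finset.sum_congr rfl fun i _ => ?_
  rw [Finset.smul_sum]
  refine Finset.sum_congr rfl fun j _ => ?_
  have h : ∀ (x y : L) (w : Fin q → L),
      ((LinearMap.llcomp ℂ L L (L [⋀^Fin q]→ₗ[ℂ] ⋀[ℂ]^(q + 1) L)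
        (exteriorPower.ιMulti ℂ (q + 1)).curryLeft) ∘ₗ
          (LieModule.toEnd ℂ L L : L →ₗ[ℂ] Module.End ℂ L)) x y w =
      (exteriorPower.ιMulti ℂ (q + 1)).curryLeft ⁅x, y⁆ w := fun _ _ _ => rfl
  rw [h, h, ← lie_skew (v j.succ), map_neg, AlternatingMap.neg_apply,
    AlternatingMap.curryLeft_apply_apply, pow_succ]
  module

/-- The differential `d_p(f) : E ⊗ ⋀^(p+1) L → E ⊗ ⋀^p L`. -/
def differential (ρ : L →ₗ⁅ℂ⁆ (E →L[ℂ] E)ᵐᵒᵖ) (f : Module.Dual ℂ L) :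
    (p : ℕ) → Chain E L (p + 1) →ₗ[ℂ] Chain E L p
  | 0 => actionPart ρ f 0
  | q + 1 => actionPart ρ f (q + 1) + (bracketMap L q).lTensor E

theorem differential_zero_tmul_ιMulti (ρ : L →ₗ⁅ℂ⁆ (E →L[ℂ] E)ᵐᵒᵖ) (f : Module.Dual ℂ L)
    (e : E) (v : Fin 1 → L) :
    differential ρ f 0 (e ⊗ₜ exteriorPower.ιMulti ℂ 1 v) =
      ((ρ (v 0)).unop e - f (v 0) • e) ⊗ₜ[ℂ] exteriorPower.ιMulti ℂ 0 (Fin.removeNth 0 v) := by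
  refine (actionPart_tmul_ιMulti ρ f 0 e v).trans ?_
  simp

/-- The closed formula for the differential (see `bracketMap_ιMulti` for the indices). -/
theorem differential_succ_tmul_ιMulti (ρ : L →ₗ⁅ℂ⁆ (E →L[ℂ] E)ᵐᵒᵖ) (f : Module.Dual ℂ L)
    (q : ℕ) (e : E) (v : Fin (q + 2) → L) :
    differential ρ f (q + 1) (e ⊗ₜ exteriorPower.ιMulti ℂ (q + 2) v) =
      ∑ k : Fin (q + 2), (-1 : ℤ) ^ (k : ℕ) •
        (((ρ (v k)).unop e - f (v k) • e) ⊗ₜ[ℂ]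
          exteriorPower.ιMulti ℂ (q + 1) (k.removeNth v)) +
      ∑ i : Fin (q + 1), ∑ j ≥ i, (-1 : ℤ) ^ (i + j + 1 : ℕ) •
        (e ⊗ₜ[ℂ] exteriorPower.ιMulti ℂ (q + 1)
          (Matrix.vecCons ⁅v i.castSucc, v j.succ⁆ (j.removeNth (i.castSucc.removeNth v)))) := by
  rw [differential, LinearMap.add_apply, actionPart_tmul_ιMulti, LinearMap.lTensor_tmul,
    bracketMap_ιMulti]
  simp [TensorProduct.tmul_sum]

/-- The `p`-cycles. -/
def cycles (ρ : L →ₗ⁅ℂ⁆ (E →L[ℂ] E)ᵐᵒᵖ) (f : Module.Dual ℂ L) :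
    (p : ℕ) → Submodule ℂ (Chain E L p)
  | 0 => ⊤
  | p + 1 => LinearMap.ker (differential ρ f p)

/-- The `p`-th homology space `H_p(L, E ⊗ ℂ(f))` of the complex `(E ⊗ ⋀ L, d(f))`. -/
abbrev Homology (ρ : L →ₗ⁅ℂ⁆ (E →L[ℂ] E)ᵐᵒᵖ) (f : Module.Dual ℂ L) (p : ℕ) : Type _ :=
  cycles ρ f p ⧸ (LinearMap.range (differential ρ f p)).submoduleOf (cycles ρ f p)

/-- The spectrum `Sp(L, E)`: the characters `f` of `L` such that `H_*(L, E ⊗ ℂ(f)) ≠ 0`. -/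
def Sp (ρ : L →ₗ⁅ℂ⁆ (E →L[ℂ] E)ᵐᵒᵖ) : Set (Module.Dual ℂ L) :=
  {f | (∀ x y : L, f ⁅x, y⁆ = 0) ∧ ∃ p : ℕ, Nontrivial (Homology ρ f p)}

end Complex

/-- The operator `a` on `ℂ²` (with the Euclidean norm). -/
def opA : EuclideanSpace ℂ (Fin 2) →L[ℂ] EuclideanSpace ℂ (Fin 2) :=
  Matrix.toEuclideanCLM (n := Fin 2) (𝕜 := ℂ) !![0, 1 / 2; 1 / 2, 0]

/-- The operator `b` on `ℂ²` (with the Euclidean norm). -/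
def opB : EuclideanSpace ℂ (Fin 2) →L[ℂ] EuclideanSpace ℂ (Fin 2) :=
  Matrix.toEuclideanCLM (n := Fin 2) (𝕜 := ℂ) !![1, 1; -1, -1]

end LieSpectrum

end

/-! For x in L let h_x(e ⊗ ω) = e ⊗ x ∧ ω, and let θ_x = (ρ(x) - f(x)) ⊗ 1 - 1 ⊗ D_x, where D_x is
the derivation of ⋀L extending ad x. Cartan's formula d h_x + h_x d = θ_x
(`differential_homotopy_succ`) and the commutation of θ_x with d (`differential_chainAction`) show
that the homology vanishes as soon as θ_x is bijective in every degree.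

If |f(x)| > ‖x‖, then ρ(x) - f(x) is invertible. For nilpotent L the operator ad x is nilpotent,
hence so is D_x, and θ_x is an invertible operator minus a commuting nilpotent one. So f lies
outside the spectrum.

In the example [a, b] = b, so D_a multiplies a ∧ b by 1, and this shifts the eigenvalue: if e·b = 0,
f(b) = 0 and e·a = (f(a) + 1)e, then e ⊗ a ∧ b is a nonzero cycle in top degree. The vector e = (1,
-1) has e·a = -e/2, so f(a) = -3/2, while ‖a‖ ≤ 1/2. -/

namespace LieSpectrum

/-! ### Exterior multiplication, the derivation extending ad x, and the bracket part of d -/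

section Wedge

variable {L : Type*} [LieRing L] [LieAlgebra ℂ L]

/-- Left multiplication `ω ↦ x ∧ ω` on the exterior powers of `L`. -/
noncomputable def wedge (p : ℕ) : L →ₗ[ℂ] (⋀[ℂ]^p L) →ₗ[ℂ] (⋀[ℂ]^(p + 1) L) :=
  exteriorPower.alternatingMapLinearEquiv.toLinearMap ∘ₗ
    (exteriorPower.ιMulti ℂ (p + 1)).curryLeft

theorem wedge_ιMulti (p : ℕ) (x : L) (v : Fin p → L) :
    wedge p x (exteriorPower.ιMulti ℂ p v) =
      exteriorPower.ιMulti ℂ (p + 1) (Matrix.vecCons x v) := by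
  simp [wedge]

/-- The products x ∧ ω span the next exterior power; this is what allows induction on the degree. -/
theorem exteriorPower_hom_ext {N : Type*} [AddCommGroup N] [Module ℂ N] {p : ℕ}
    {F G : (⋀[ℂ]^(p + 1) L) →ₗ[ℂ] N} (h : ∀ x ω, F (wedge p x ω) = G (wedge p x ω)) : F = G := by
  refine exteriorPower.linearMap_ext (AlternatingMap.ext fun v => ?_)
  have := h (v 0) (exteriorPower.ιMulti ℂ p (Fin.tail v))
  rw [wedge_ιMulti] at this
  have hv : Matrix.vecCons (v 0) (Fin.tail v) = v := Fin.cons_self_tail v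
  rw [hv] at this
  exact this

theorem removeNth_succ_vecCons {α : Type*} {n : ℕ} (x : α) (v : Fin (n + 1) → α)
    (k : Fin (n + 1)) :
    k.succ.removeNth (Matrix.vecCons x v : Fin (n + 2) → α) = Matrix.vecCons x (k.removeNth v) := by
  funext i
  refine Fin.cases ?_ (fun i => ?_) i
  · simp [Fin.removeNth_apply]
  · simp [Fin.removeNth_apply]

theorem removeNth_zero_vecCons {α : Type*} {n : ℕ} (x : α) (v : Fin n → α) :
    (0 : Fin (n + 1)).removeNth (Matrix.vecCons x v : Fin (n + 1) → α) = v := by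
  funext i
  simp [Fin.removeNth_apply]

theorem wedge_wedge_swap (p : ℕ) (x y : L) (ω : ⋀[ℂ]^p L) :
    wedge (p + 1) x (wedge p y ω) = -wedge (p + 1) y (wedge p x ω) := by
  suffices h : wedge (p + 1) x ∘ₗ wedge p y = -(wedge (p + 1) y ∘ₗ wedge p x) from
    LinearMap.congr_fun h ω
  refine exteriorPower.linearMap_ext (AlternatingMap.ext fun v => ?_)
  have h := (exteriorPower.ιMulti ℂ (p + 2)).map_swap
    (Matrix.vecCons y (Matrix.vecCons x v) : Fin (p + 2) → L) (i := 0) (j := 1) (by simp)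
  have hs : (Matrix.vecCons y (Matrix.vecCons x v) : Fin (p + 2) → L) ∘ Equiv.swap 0 1 =
      Matrix.vecCons x (Matrix.vecCons y v) := by
    funext i
    refine Fin.cases ?_ (fun i => ?_) i
    · simp
    · refine Fin.cases ?_ (fun i => ?_) i
      · simp
      · have h0 : i.succ.succ ≠ (0 : Fin (p + 2)) := Fin.succ_ne_zero _
        have h1 : i.succ.succ ≠ (1 : Fin (p + 2)) := by
          rw [← Fin.succ_zero_eq_one]
          exact fun h => Fin.succ_ne_zero _ (Fin.succ_injective _ h)
        simp [Equiv.swap_apply_of_ne_of_ne h0 h1]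
  rw [hs] at h
  simpa [wedge_ιMulti] using h

/-- The derivation of the exterior powers of `L` extending `ad x`. -/
noncomputable def adDerivation (x : L) : (p : ℕ) → (⋀[ℂ]^p L) →ₗ[ℂ] (⋀[ℂ]^p L)
  | 0 => 0
  | p + 1 => exteriorPower.alternatingMapLinearEquiv <| AlternatingMap.alternatizeUncurryFin <|
      (exteriorPower.ιMulti ℂ (p + 1)).curryLeft ∘ₗ (LieAlgebra.ad ℂ L x)

theorem adDerivation_ιMulti (x : L) (p : ℕ) (v : Fin (p + 1) → L) :
    adDerivation x (p + 1) (exteriorPower.ιMulti ℂ (p + 1) v) =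
      ∑ k : Fin (p + 1), (-1 : ℤ) ^ (k : ℕ) •
        exteriorPower.ιMulti ℂ (p + 1) (Matrix.vecCons ⁅x, v k⁆ (k.removeNth v)) := by
  simp [adDerivation, AlternatingMap.alternatizeUncurryFin_apply]

/-- Leibniz rule: the term k = 0 gives [x, y] ∧ ω, and in the others moving y to the front past [x,
v k] absorbs one sign. -/
theorem adDerivation_wedge (x y : L) (p : ℕ) (ω : ⋀[ℂ]^p L) :
    adDerivation x (p + 1) (wedge p y ω) =
      wedge p ⁅x, y⁆ ω + wedge p y (adDerivation x p ω) := by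
  suffices h : adDerivation x (p + 1) ∘ₗ wedge p y =
      wedge p ⁅x, y⁆ + wedge p y ∘ₗ adDerivation x p from LinearMap.congr_fun h ω
  refine exteriorPower.linearMap_ext (AlternatingMap.ext fun v => ?_)
  simp only [LinearMap.compAlternatingMap_apply, LinearMap.comp_apply, LinearMap.add_apply,
    wedge_ιMulti]
  rw [adDerivation_ιMulti, Fin.sum_univ_succ, removeNth_zero_vecCons]
  congr 1
  · simp
  · cases p with
    | zero => simp [adDerivation]
    | succ p =>
      rw [adDerivation_ιMulti, map_sum]
      refine Finset.sum_congr rfl fun k _ => ?_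
      rw [removeNth_succ_vecCons, map_zsmul, ← wedge_ιMulti, ← wedge_ιMulti, wedge_wedge_swap,
        ← wedge_ιMulti, Matrix.cons_val_succ, Fin.val_succ, pow_succ]
      module

theorem adDerivation_lie (x y : L) (p : ℕ) (ω : ⋀[ℂ]^p L) :
    adDerivation ⁅x, y⁆ p ω =
      adDerivation x p (adDerivation y p ω) - adDerivation y p (adDerivation x p ω) := by
  induction p with
  | zero => simp [adDerivation]
  | succ p ih =>
    suffices h : adDerivation ⁅x, y⁆ (p + 1) =
        adDerivation x (p + 1) ∘ₗ adDerivation y (p + 1) -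
          adDerivation y (p + 1) ∘ₗ adDerivation x (p + 1) from LinearMap.congr_fun h ω
    refine exteriorPower_hom_ext fun z ω => ?_
    simp only [LinearMap.sub_apply, LinearMap.comp_apply, adDerivation_wedge, map_add, ih, map_sub,
      lie_lie, LinearMap.sub_apply]
    abel

/-- By the Leibniz rule the surjection L ⊗ ⋀^p → ⋀^(p+1) intertwines ad x ⊗ 1 + 1 ⊗ D_x with D_x,
and the former is a sum of commuting nilpotents. -/
theorem isNilpotent_adDerivation (x : L) (hx : IsNilpotent (LieAlgebra.ad ℂ L x)) (p : ℕ) :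
    IsNilpotent (adDerivation x p) := by
  induction p with
  | zero => exact IsNilpotent.zero
  | succ p ih =>
    let A : Module.End ℂ (L ⊗[ℂ] (⋀[ℂ]^p L)) := (LieAlgebra.ad ℂ L x).rTensor _
    let B : Module.End ℂ (L ⊗[ℂ] (⋀[ℂ]^p L)) := (adDerivation x p).lTensor L
    have hA : IsNilpotent A := by
      obtain ⟨n, hn⟩ := hx
      exact ⟨n, by simp only [A, LinearMap.rTensor_pow, hn, LinearMap.rTensor_zero]⟩
    have hB : IsNilpotent B := by
      obtain ⟨n, hn⟩ := ih
      exact ⟨n, by simp only [B, LinearMap.lTensor_pow, hn, LinearMap.lTensor_zero]⟩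
    have hAB : Commute A B := by
      refine TensorProduct.ext' fun y ω => ?_
      simp [A, B]
    obtain ⟨n, hn⟩ := hAB.isNilpotent_add hA hB
    let π : L ⊗[ℂ] (⋀[ℂ]^p L) →ₗ[ℂ] (⋀[ℂ]^(p + 1) L) := TensorProduct.lift (wedge p)
    have hπ : ∀ t, adDerivation x (p + 1) (π t) = π ((A + B) t) := fun t => by
      suffices h : adDerivation x (p + 1) ∘ₗ π = π ∘ₗ (A + B) from LinearMap.congr_fun h t
      refine TensorProduct.ext' fun y ω => ?_
      simp [A, B, π, adDerivation_wedge]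
    have hpow : ∀ (m : ℕ) t, (adDerivation x (p + 1) ^ m) (π t) = π (((A + B) ^ m) t) := by
      intro m
      induction m with
      | zero => simp
      | succ m ihm => intro t; rw [pow_succ, pow_succ, Module.End.mul_apply, hπ, ihm]; rfl
    refine ⟨n, exteriorPower_hom_ext fun y ω => ?_⟩
    have := hpow n (y ⊗ₜ ω)
    rw [hn] at this
    simpa [π] using this

/-- The bracket part of the differential in all degrees. -/
noncomputable def bracketPart (L : Type*) [LieRing L] [LieAlgebra ℂ L] :
    (p : ℕ) → (⋀[ℂ]^(p + 1) L) →ₗ[ℂ] (⋀[ℂ]^p L)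
  | 0 => 0
  | q + 1 => bracketMap L q

/-- The pairs k < l with k = 0 contribute -D_x; those with k > 0 leave x in place and contribute the
second term. -/
theorem bracketPart_wedge (p : ℕ) (x : L) (ω : ⋀[ℂ]^(p + 1) L) :
    bracketPart L (p + 1) (wedge (p + 1) x ω) =
      -adDerivation x (p + 1) ω - wedge p x (bracketPart L p ω) := by
  suffices h : bracketPart L (p + 1) ∘ₗ wedge (p + 1) x =
      -adDerivation x (p + 1) - wedge p x ∘ₗ bracketPart L p from LinearMap.congr_fun h ω
  refine exteriorPower.linearMap_ext (AlternatingMap.ext fun v => ?_)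
  simp only [LinearMap.compAlternatingMap_apply, LinearMap.comp_apply, LinearMap.sub_apply,
    LinearMap.neg_apply, wedge_ιMulti]
  rw [show bracketPart L (p + 1) = bracketMap L p from rfl, bracketMap_ιMulti, Fin.sum_univ_succ, sub_eq_add_neg, adDerivation_ιMulti,
    ← Finset.sum_neg_distrib]
  congr 1
  · refine Finset.sum_congr (by ext; simp) fun k _ => ?_
    rw [Fin.castSucc_zero, removeNth_zero_vecCons, Matrix.cons_val_zero, Matrix.cons_val_succ,
      Fin.val_zero, zero_add, pow_succ]
    module
  · cases p with
    | zero => simp [bracketPart]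
    | succ q =>
      rw [show bracketPart L (q + 1) = bracketMap L q from rfl, bracketMap_ιMulti, map_sum, ← Finset.sum_neg_distrib]
      refine Finset.sum_congr rfl fun i _ => ?_
      rw [map_sum, ← Finset.sum_neg_distrib]
      have hI : Finset.Ici i.succ =
          (Finset.Ici i).map (Fin.succEmb _) := by
        ext j
        refine Fin.cases ?_ (fun j => ?_) j
        · simp
        · simp
      rw [hI, Finset.sum_map]
      refine Finset.sum_congr (by ext; simp) fun j _ => ?_
      rw [← Fin.succ_castSucc, removeNth_succ_vecCons]
      simp only [Fin.coe_succEmb, removeNth_succ_vecCons, Matrix.cons_val_succ, map_zsmul]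
      rw [← wedge_ιMulti, ← wedge_ιMulti, wedge_wedge_swap, ← wedge_ιMulti, Fin.val_succ,
        Fin.val_succ, show (i : ℕ) + 1 + (j + 1) + 1 = i + j + 1 + 2 by ring, pow_add]
      simp

end Wedge

/-! ### Cartan's formula and vanishing of the homology -/

section Homotopy

variable {L : Type*} [LieRing L] [LieAlgebra ℂ L]
variable {E : Type*} [NormedAddCommGroup E] [NormedSpace ℂ E]

theorem differential_eq (ρ : L →ₗ⁅ℂ⁆ (E →L[ℂ] E)ᵐᵒᵖ) (f : Module.Dual ℂ L) (p : ℕ) :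
    differential ρ f p = actionPart ρ f p + (bracketPart L p).lTensor E := by
  cases p with
  | zero => simp [differential, bracketPart]
  | succ q => rfl

/-- The contracting homotopy `e ⊗ ω ↦ e ⊗ x ∧ ω`. -/
noncomputable def homotopy (E : Type*) [NormedAddCommGroup E] [NormedSpace ℂ E] (x : L) (p : ℕ) :
    Chain E L p →ₗ[ℂ] Chain E L (p + 1) :=
  (wedge p x).lTensor E

theorem homotopy_tmul (x : L) (p : ℕ) (e : E) (ω : ⋀[ℂ]^p L) :
    homotopy E x p (e ⊗ₜ ω) = e ⊗ₜ wedge p x ω := rfl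

theorem chain_hom_ext {N : Type*} [AddCommGroup N] [Module ℂ N] {p : ℕ}
    {F G : Chain E L (p + 1) →ₗ[ℂ] N}
    (h : ∀ x c, F (homotopy E x p c) = G (homotopy E x p c)) : F = G := by
  refine TensorProduct.ext (LinearMap.ext fun e => exteriorPower_hom_ext fun x ω => ?_)
  exact h x (e ⊗ₜ ω)

/-- The action of `x` on the complex `E ⊗ ⋀ L` twisted by `f`. -/
noncomputable def chainAction (ρ : L →ₗ⁅ℂ⁆ (E →L[ℂ] E)ᵐᵒᵖ) (f : Module.Dual ℂ L) (x : L) (p : ℕ) :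
    Chain E L p →ₗ[ℂ] Chain E L p :=
  (shiftedAction ρ f x).rTensor _ - (adDerivation x p).lTensor E

variable (ρ : L →ₗ⁅ℂ⁆ (E →L[ℂ] E)ᵐᵒᵖ) (f : Module.Dual ℂ L)

theorem chainAction_tmul (x : L) (p : ℕ) (e : E) (ω : ⋀[ℂ]^p L) :
    chainAction ρ f x p (e ⊗ₜ ω) = shiftedAction ρ f x e ⊗ₜ ω - e ⊗ₜ adDerivation x p ω := rfl

theorem actionPart_homotopy_zero (x : L) (c : Chain E L 0) :
    actionPart ρ f 0 (homotopy E x 0 c) = (shiftedAction ρ f x).rTensor _ c := by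
  suffices h : actionPart ρ f 0 ∘ₗ homotopy E x 0 = (shiftedAction ρ f x).rTensor _ from
    LinearMap.congr_fun h c
  refine TensorProduct.ext (LinearMap.ext fun e => exteriorPower.linearMap_ext
    (AlternatingMap.ext fun v => ?_))
  simp only [LinearMap.compAlternatingMap_apply, LinearMap.compr₂ₛₗ_apply, TensorProduct.mk_apply,
    LinearMap.comp_apply, homotopy_tmul, wedge_ιMulti, LinearMap.rTensor_tmul]
  rw [actionPart_tmul_ιMulti, Fin.sum_univ_succ, removeNth_zero_vecCons]
  simp [shiftedAction_apply]

theorem actionPart_homotopy_succ (x : L) (p : ℕ) (c : Chain E L (p + 1)) :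
    actionPart ρ f (p + 1) (homotopy E x (p + 1) c) =
      (shiftedAction ρ f x).rTensor _ c - homotopy E x p (actionPart ρ f p c) := by
  suffices h : actionPart ρ f (p + 1) ∘ₗ homotopy E x (p + 1) =
      (shiftedAction ρ f x).rTensor _ - homotopy E x p ∘ₗ actionPart ρ f p from
    LinearMap.congr_fun h c
  refine TensorProduct.ext (LinearMap.ext fun e => exteriorPower.linearMap_ext
    (AlternatingMap.ext fun v => ?_))
  simp only [LinearMap.compAlternatingMap_apply, LinearMap.compr₂ₛₗ_apply, TensorProduct.mk_apply,
    LinearMap.comp_apply, homotopy_tmul, wedge_ιMulti, LinearMap.rTensor_tmul,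
    LinearMap.sub_apply]
  rw [actionPart_tmul_ιMulti, actionPart_tmul_ιMulti, Fin.sum_univ_succ, removeNth_zero_vecCons,
    map_sum, sub_eq_add_neg (shiftedAction ρ f x e ⊗ₜ[ℂ] _), ← Finset.sum_neg_distrib]
  congr 1
  · simp [shiftedAction_apply]
  · refine Finset.sum_congr rfl fun k _ => ?_
    rw [removeNth_succ_vecCons, map_zsmul, homotopy_tmul, wedge_ιMulti, Matrix.cons_val_succ,
      Fin.val_succ, pow_succ]
    module

theorem differential_homotopy_zero (x : L) (c : Chain E L 0) :
    differential ρ f 0 (homotopy E x 0 c) = chainAction ρ f x 0 c := by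
  simp [differential, actionPart_homotopy_zero, chainAction, adDerivation]

/-- Cartan's homotopy formula. -/
theorem differential_homotopy_succ (x : L) (p : ℕ) (c : Chain E L (p + 1)) :
    differential ρ f (p + 1) (homotopy E x (p + 1) c) =
      chainAction ρ f x (p + 1) c - homotopy E x p (differential ρ f p c) := by
  have hb : (bracketPart L (p + 1)).lTensor E (homotopy E x (p + 1) c) =
      -(adDerivation x (p + 1)).lTensor E c - homotopy E x p ((bracketPart L p).lTensor E c) := by
    induction c using TensorProduct.induction_on with
    | zero => simp
    | tmul e ω =>
      simp [homotopy_tmul, bracketPart_wedge, TensorProduct.tmul_sub, TensorProduct.tmul_neg]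
    | add a b ha hb => simp only [map_add, ha, hb]; abel
  simp only [differential_eq, LinearMap.add_apply, hb, actionPart_homotopy_succ, chainAction,
    LinearMap.sub_apply, map_add]
  abel

theorem chainAction_homotopy (x y : L) (p : ℕ) (c : Chain E L p) :
    chainAction ρ f x (p + 1) (homotopy E y p c) =
      homotopy E y p (chainAction ρ f x p c) - homotopy E ⁅x, y⁆ p c := by
  induction c using TensorProduct.induction_on with
  | zero => simp
  | tmul e ω =>
    simp only [homotopy_tmul, chainAction_tmul, adDerivation_wedge, TensorProduct.tmul_add,
      map_sub]
    abel
  | add a b ha hb => simp only [map_add, ha, hb]; abel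

theorem shiftedAction_lie (hf : ∀ x y : L, f ⁅x, y⁆ = 0) (x y : L) (e : E) :
    shiftedAction ρ f ⁅x, y⁆ e =
      shiftedAction ρ f y (shiftedAction ρ f x e) -
        shiftedAction ρ f x (shiftedAction ρ f y e) := by
  simp only [shiftedAction_apply, hf, LieHom.map_lie, LieRing.of_associative_ring_bracket,
    MulOpposite.unop_sub, MulOpposite.unop_mul, sub_apply,
    ContinuousLinearMap.mul_def, ContinuousLinearMap.comp_apply, map_sub, map_smul]
  module

theorem chainAction_lie (hf : ∀ x y : L, f ⁅x, y⁆ = 0) (x y : L) (p : ℕ) (c : Chain E L p) :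
    chainAction ρ f ⁅x, y⁆ p c =
      chainAction ρ f y p (chainAction ρ f x p c) -
        chainAction ρ f x p (chainAction ρ f y p c) := by
  induction c using TensorProduct.induction_on with
  | zero => simp
  | tmul e ω =>
    simp only [chainAction_tmul, map_sub, shiftedAction_lie ρ f hf, adDerivation_lie,
      TensorProduct.tmul_sub, TensorProduct.sub_tmul]
    abel
  | add a b ha hb => simp only [map_add, ha, hb]; abel

/-- Induction on the degree, testing on chains h_y c: Cartan's formula and the commutation rules of
θ_x with h_y and θ_y reduce the claim to one degree lower. The identity d² = 0 is not needed. -/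
theorem differential_chainAction (hf : ∀ x y : L, f ⁅x, y⁆ = 0) (x : L) (p : ℕ)
    (c : Chain E L (p + 1)) :
    differential ρ f p (chainAction ρ f x (p + 1) c) =
      chainAction ρ f x p (differential ρ f p c) := by
  induction p with
  | zero =>
    suffices h : differential ρ f 0 ∘ₗ chainAction ρ f x 1 =
        chainAction ρ f x 0 ∘ₗ differential ρ f 0 from LinearMap.congr_fun h c
    refine chain_hom_ext fun y c => ?_
    simp only [LinearMap.comp_apply, chainAction_homotopy, map_sub, differential_homotopy_zero,
      chainAction_lie ρ f hf]
    abel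
  | succ p ih =>
    suffices h : differential ρ f (p + 1) ∘ₗ chainAction ρ f x (p + 2) =
        chainAction ρ f x (p + 1) ∘ₗ differential ρ f (p + 1) from LinearMap.congr_fun h c
    refine chain_hom_ext fun y c => ?_
    simp only [LinearMap.comp_apply, chainAction_homotopy, map_sub, differential_homotopy_succ,
      chainAction_lie ρ f hf, ih]
    abel

theorem subsingleton_homology_of_isUnit_chainAction (hf : ∀ x y : L, f ⁅x, y⁆ = 0) (x : L)
    (hx : ∀ p, IsUnit (chainAction ρ f x p : Module.End ℂ (Chain E L p))) (p : ℕ) :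
    Subsingleton (Homology ρ f p) := by
  rw [Submodule.Quotient.subsingleton_iff, Submodule.submoduleOf_eq_top]
  intro c hc
  obtain ⟨c', rfl⟩ := ((Module.End.isUnit_iff _).1 (hx p)).2 c
  cases p with
  | zero => exact ⟨homotopy E x 0 c', differential_homotopy_zero ρ f x c'⟩
  | succ p =>
    refine ⟨homotopy E x (p + 1) c', ?_⟩
    -- Writing the cycle as θ_x c', injectivity of θ_x one degree lower makes c' a cycle, so
    -- Cartan's formula gives θ_x c' = d h_x c'.
    have h : chainAction ρ f x p (differential ρ f p c') = 0 := by
      rw [← differential_chainAction ρ f hf]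
      exact hc
    have h0 : differential ρ f p c' = 0 :=
      ((Module.End.isUnit_iff _).1 (hx p)).1 (h.trans (map_zero _).symm)
    rw [differential_homotopy_succ, h0, map_zero, sub_zero]

theorem isUnit_chainAction {x : L} (hx : IsNilpotent (LieAlgebra.ad ℂ L x))
    (hu : IsUnit (shiftedAction ρ f x : Module.End ℂ E)) (p : ℕ) :
    IsUnit (chainAction ρ f x p : Module.End ℂ (Chain E L p)) := by
  let A : Module.End ℂ (Chain E L p) := (shiftedAction ρ f x).rTensor _
  let B : Module.End ℂ (Chain E L p) := (adDerivation x p).lTensor E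
  have hA : IsUnit A := hu.map (Module.End.rTensorAlgHom ℂ E (⋀[ℂ]^p L))
  have hB : IsNilpotent B := by
    obtain ⟨n, hn⟩ := isNilpotent_adDerivation x hx p
    exact ⟨n, by simp only [B, LinearMap.lTensor_pow, hn, LinearMap.lTensor_zero]⟩
  have hAB : Commute B A := by
    refine TensorProduct.ext' fun y ω => ?_
    simp [A, B]
  have := hB.neg.isUnit_add_left_of_commute hA hAB.neg_left
  rwa [← sub_eq_add_neg] at this

theorem isUnit_shiftedAction [CompleteSpace E] {x : L} (hx : ‖(ρ x).unop‖ < ‖f x‖) :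
    IsUnit (shiftedAction ρ f x : Module.End ℂ E) := by
  have h : f x ∉ spectrum ℂ (ρ x).unop := fun hm => by
    have h1 := spectrum.norm_le_norm_mul_of_mem hm
    -- Only an inequality, since the identity has norm 0 when E = 0.
    have h2 : ‖(1 : E →L[ℂ] E)‖ ≤ 1 := ContinuousLinearMap.norm_id_le
    exact absurd (h1.trans (mul_le_of_le_one_right (norm_nonneg _) h2)) hx.not_ge
  have h' := (spectrum.notMem_iff.1 h).neg.map
    (ContinuousLinearMap.toLinearMapRingHom : (E →L[ℂ] E) →+* (E →ₗ[ℂ] E))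
  convert h' using 1
  ext e
  simp [shiftedAction_apply, Algebra.algebraMap_eq_smul_one]

theorem norm_le_of_mem_Sp [CompleteSpace E] {x : L} (hx : IsNilpotent (LieAlgebra.ad ℂ L x))
    {f : Module.Dual ℂ L} (hf : f ∈ Sp ρ) : ‖f x‖ ≤ ‖(ρ x).unop‖ := by
  by_contra! h
  obtain ⟨p, hp⟩ := hf.2
  exact not_subsingleton _ (subsingleton_homology_of_isUnit_chainAction ρ f hf.1 x
    (isUnit_chainAction ρ f hx (isUnit_shiftedAction ρ f h)) p)

end Homotopy

/-! ### The two-dimensional Lie algebra with [B 0, B 1] = B 1 -/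

section TwoDimensional

variable {L : Type*} [LieRing L] [LieAlgebra ℂ L]

theorem lie_eq_smul_of_basis (B : Module.Basis (Fin 2) ℂ L) (hB : ⁅B 0, B 1⁆ = B 1) (x y : L) :
    ⁅x, y⁆ = (B.repr x 0 * B.repr y 1 - B.repr x 1 * B.repr y 0) • B 1 := by
  have hB' : ⁅B 1, B 0⁆ = -B 1 := by rw [← lie_skew, hB]
  conv_lhs => rw [← B.sum_repr x, ← B.sum_repr y]
  simp only [Fin.sum_univ_two, lie_add, add_lie, lie_smul, smul_lie, lie_self, hB, hB']
  module

theorem isSolvable_of_basis (B : Module.Basis (Fin 2) ℂ L) (hB : ⁅B 0, B 1⁆ = B 1) :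
    LieAlgebra.IsSolvable L := by
  let K : LieIdeal ℂ L :=
    { __ := Submodule.span ℂ {B 1}
      lie_mem := fun {x y} _ => by
        rw [lie_eq_smul_of_basis B hB]
        exact Submodule.smul_mem _ _ (Submodule.mem_span_singleton_self _) }
  have h1 : LieAlgebra.derivedSeries ℂ L 1 ≤ K := by
    rw [LieAlgebra.derivedSeries_def, LieAlgebra.derivedSeriesOfIdeal_succ, LieSubmodule.lie_le_iff]
    intro x _ y _
    rw [lie_eq_smul_of_basis B hB]
    exact Submodule.smul_mem _ _ (Submodule.mem_span_singleton_self _)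
  refine LieAlgebra.IsSolvable.mk (R := ℂ) (k := 2) ?_
  rw [LieAlgebra.derivedSeries_def, LieAlgebra.derivedSeriesOfIdeal_succ, eq_bot_iff,
    LieSubmodule.lie_le_iff]
  intro x hx y hy
  obtain ⟨s, rfl⟩ := Submodule.mem_span_singleton.1 (h1 hx)
  obtain ⟨t, rfl⟩ := Submodule.mem_span_singleton.1 (h1 hy)
  simp

theorem not_isNilpotent_of_basis (B : Module.Basis (Fin 2) ℂ L) (hB : ⁅B 0, B 1⁆ = B 1) :
    ¬ LieRing.IsNilpotent L := by
  intro h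
  obtain ⟨n, hn⟩ := LieModule.isNilpotent_toEnd_of_isNilpotent ℂ L L (B 0)
  have hfix : ∀ m : ℕ, ((LieModule.toEnd ℂ L L (B 0)) ^ m) (B 1) = B 1 := by
    intro m
    induction m with
    | zero => simp
    | succ m ih => rw [pow_succ, Module.End.mul_apply, LieModule.toEnd_apply_apply, hB, ih]
  have := hfix n
  rw [hn] at this
  exact B.ne_zero 1 this.symm

/-- As ⋀³L = 0 there are no boundaries in degree 2, so one nonzero cycle suffices. -/
theorem nontrivial_homology_two_of_basis {E : Type*} [NormedAddCommGroup E] [NormedSpace ℂ E]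
    (ρ : L →ₗ⁅ℂ⁆ (E →L[ℂ] E)ᵐᵒᵖ) (f : Module.Dual ℂ L) (B : Module.Basis (Fin 2) ℂ L)
    (hB : ⁅B 0, B 1⁆ = B 1) (hf : f (B 1) = 0) {e : E} (he : e ≠ 0)
    (h0 : (ρ (B 0)).unop e = (f (B 0) + 1) • e) (h1 : (ρ (B 1)).unop e = 0) :
    Nontrivial (Homology ρ f 2) := by
  have hfin : FiniteDimensional ℂ L := B.finiteDimensional_of_finite
  have h3 : Subsingleton (⋀[ℂ]^3 L) := by
    rw [← Module.finrank_zero_iff (R := ℂ), exteriorPower.finrank_eq,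
      Module.finrank_eq_card_basis B]
    rfl
  have hsub : Subsingleton (Chain E L 3) := by
    refine ⟨fun s t => ?_⟩
    have hz : ∀ u : Chain E L 3, u = 0 := fun u => by
      induction u using TensorProduct.induction_on with
      | zero => rfl
      | tmul e ω => rw [Subsingleton.elim ω 0, TensorProduct.tmul_zero]
      | add a b ha hb => rw [ha, hb, add_zero]
    rw [hz s, hz t]
  let c : Chain E L 2 := e ⊗ₜ exteriorPower.ιMulti ℂ 2 B
  have hcycle : c ∈ cycles ρ f 2 := by
    change differential ρ f 1 c = 0
    have hr1 : (0 : Fin 2).removeNth (⇑B : Fin 2 → L) = ![B 1] := by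
      ext i; fin_cases i; rfl
    have hr0 : (1 : Fin 2).removeNth (⇑B : Fin 2 → L) = ![B 0] := by
      ext i; fin_cases i; rfl
    have hd : differential ρ f 1 c =
        ∑ k : Fin 2, (-1 : ℤ) ^ (k : ℕ) • (((ρ (B k)).unop e - f (B k) • e) ⊗ₜ[ℂ]
          exteriorPower.ιMulti ℂ 1 (k.removeNth (⇑B : Fin 2 → L))) +
        -(e ⊗ₜ[ℂ] exteriorPower.ιMulti ℂ 1 ![⁅B 0, B 1⁆]) := by
      refine (differential_succ_tmul_ιMulti ρ f 0 e B).trans (congrArg₂ _ rfl ?_)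
      refine (Fin.sum_univ_one _).trans ((Finset.sum_singleton _ (0 : Fin 1)).trans ?_)
      simp only [Fin.val_zero, zero_add, pow_one, neg_smul, one_smul]
      congr 4
      exact Subsingleton.elim _ _
    rw [hd, Fin.sum_univ_two, hr0, hr1, h0, h1, hf, hB]
    simp [add_smul]
  have hc : c ≠ 0 := by
    intro h
    -- The determinant sends B 0 ∧ B 1 to 1, so applying it to the second factor recovers e.
    let φ : (⋀[ℂ]^2 L) →ₗ[ℂ] ℂ := exteriorPower.alternatingMapLinearEquiv B.det
    have hφ := congrArg (TensorProduct.rid ℂ E) (congrArg (φ.lTensor E) h)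
    have hdet : φ (exteriorPower.ιMulti ℂ 2 B) = 1 := by
      simp [φ, B.det_self]
    simp only [c, LinearMap.lTensor_tmul, hdet, TensorProduct.rid_tmul, one_smul, map_zero] at hφ
    exact he hφ
  rw [Submodule.Quotient.nontrivial_iff, Ne, Submodule.submoduleOf_eq_top]
  intro hle
  obtain ⟨u, hu⟩ := hle hcycle
  rw [Subsingleton.elim u 0, map_zero] at hu
  exact hc hu.symm

theorem character_of_basis (f : Module.Dual ℂ L) (B : Module.Basis (Fin 2) ℂ L)
    (hB : ⁅B 0, B 1⁆ = B 1) (hf : f (B 1) = 0) (x y : L) : f ⁅x, y⁆ = 0 := by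
  rw [lie_eq_smul_of_basis B hB, map_smul, hf, smul_zero]

end TwoDimensional

/-! ### The operators a and b on ℂ² -/

section Example

theorem opA_apply (x : EuclideanSpace ℂ (Fin 2)) :
    opA x = !₂[x 1 / 2, x 0 / 2] := by
  ext i
  fin_cases i
  · simp [opA, Matrix.ofLp_toEuclideanCLM, Matrix.mulVec, dotProduct]; ring
  · simp [opA, Matrix.ofLp_toEuclideanCLM, Matrix.mulVec, dotProduct]; ring

theorem opB_apply (x : EuclideanSpace ℂ (Fin 2)) :
    opB x = !₂[x 0 + x 1, -x 0 - x 1] := by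
  ext i
  fin_cases i
  · simp [opB, Matrix.ofLp_toEuclideanCLM, Matrix.mulVec, dotProduct]
  · simp [opB, Matrix.ofLp_toEuclideanCLM, Matrix.mulVec, dotProduct]; ring

theorem norm_opA_le : ‖opA‖ ≤ 1 / 2 := by
  refine ContinuousLinearMap.opNorm_le_bound _ (by norm_num) fun x => ?_
  -- The operator a is half the coordinate swap, which is an isometry.
  rw [← sq_le_sq₀ (norm_nonneg _) (by positivity), mul_pow, EuclideanSpace.norm_sq_eq,
    EuclideanSpace.norm_sq_eq, opA_apply]
  simp [Fin.sum_univ_two, div_pow]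
  linarith

/-- For the opposite product the commutator is ba - ab in matrices. -/
theorem lie_op_opA_op_opB :
    ⁅MulOpposite.op opA, MulOpposite.op opB⁆ = MulOpposite.op opB := by
  rw [LieRing.of_associative_ring_bracket, ← MulOpposite.op_mul, ← MulOpposite.op_mul,
    ← MulOpposite.op_sub]
  congr 1
  ext x i
  fin_cases i
  · simp [opA_apply, opB_apply]; ring
  · simp [opA_apply, opB_apply]; ring

theorem eq_zero_of_smul_opA_add_smul_opB {s t : ℂ}
    (h : s • MulOpposite.op opA + t • MulOpposite.op opB = 0) : s = 0 ∧ t = 0 := by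
  have h' := congrArg (fun u => (MulOpposite.unop u) !₂[1, 0]) h
  have h0 := congrArg (fun u : EuclideanSpace ℂ (Fin 2) => u 0) h'
  have h1 := congrArg (fun u : EuclideanSpace ℂ (Fin 2) => u 1) h'
  simp [opA_apply, opB_apply] at h0 h1
  subst h0
  simpa using h1

/-- The Lie algebra of operators spanned by `opA` and `opB`, with the opposite product. -/
noncomputable def spanAB : LieSubalgebra ℂ (EuclideanSpace ℂ (Fin 2) →L[ℂ] EuclideanSpace ℂ (Fin 2))ᵐᵒᵖ where
  toSubmodule := Submodule.span ℂ {MulOpposite.op opA, MulOpposite.op opB}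
  lie_mem' := by
    intro x y hx hy
    obtain ⟨s, t, rfl⟩ := Submodule.mem_span_pair.1 hx
    obtain ⟨s', t', rfl⟩ := Submodule.mem_span_pair.1 hy
    refine Submodule.mem_span_pair.2 ⟨0, s * t' - t * s', ?_⟩
    have h : ⁅MulOpposite.op opB, MulOpposite.op opA⁆ = -MulOpposite.op opB := by
      rw [← lie_skew, lie_op_opA_op_opB]
    simp only [lie_add, add_lie, lie_smul, smul_lie, lie_self, lie_op_opA_op_opB, h]
    module

/-- The basis `opA, opB` of `spanAB`. -/
noncomputable def basisAB : Module.Basis (Fin 2) ℂ spanAB :=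
  Module.Basis.mk
    (v := ![⟨MulOpposite.op opA, Submodule.subset_span (by simp)⟩,
      ⟨MulOpposite.op opB, Submodule.subset_span (by simp)⟩])
    (LinearIndependent.pair_iff.2 fun _ _ h =>
      eq_zero_of_smul_opA_add_smul_opB (congrArg Subtype.val h))
    (by
      rintro ⟨x, hx⟩ -
      obtain ⟨s, t, rfl⟩ := Submodule.mem_span_pair.1 hx
      rw [Matrix.range_cons, Matrix.range_cons, Matrix.range_empty, Set.union_empty,
        Set.singleton_union]
      exact Submodule.mem_span_pair.2 ⟨s, t, rfl⟩)

theorem coe_basisAB_zero : (basisAB 0 : (EuclideanSpace ℂ (Fin 2) →L[ℂ] _)ᵐᵒᵖ) =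
    MulOpposite.op opA := by
  simp [basisAB]

theorem coe_basisAB_one : (basisAB 1 : (EuclideanSpace ℂ (Fin 2) →L[ℂ] _)ᵐᵒᵖ) =
    MulOpposite.op opB := by
  simp [basisAB]

theorem lie_basisAB : ⁅basisAB 0, basisAB 1⁆ = basisAB 1 := by
  apply Subtype.ext
  rw [LieSubalgebra.coe_bracket, coe_basisAB_zero, coe_basisAB_one, lie_op_opA_op_opB]

theorem exists_mem_Sp_norm_lt :
    ∃ f ∈ Sp spanAB.incl, ∃ x : spanAB, ‖(x : (EuclideanSpace ℂ (Fin 2) →L[ℂ]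
        EuclideanSpace ℂ (Fin 2))ᵐᵒᵖ).unop‖ < ‖f x‖ := by
  -- The value -3/2 solves f(a) + 1 = -1/2, the eigenvalue of a at (1, -1).
  let f : Module.Dual ℂ spanAB := (-(3 / 2) : ℂ) • basisAB.coord 0
  have hf0 : f (basisAB 0) = -(3 / 2) := by simp [f]
  have hf1 : f (basisAB 1) = 0 := by simp [f]
  have he : (!₂[1, -1] : EuclideanSpace ℂ (Fin 2)) ≠ 0 := fun h => by
    simpa using congrArg (fun u : EuclideanSpace ℂ (Fin 2) => u 0) h
  refine ⟨f, ⟨character_of_basis f basisAB lie_basisAB hf1, 2,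
    nontrivial_homology_two_of_basis _ f basisAB lie_basisAB hf1 he ?_ ?_⟩, basisAB 0, ?_⟩
  · rw [hf0, LieSubalgebra.coe_incl, coe_basisAB_zero, MulOpposite.unop_op, opA_apply]
    ext i
    fin_cases i
    · simp; norm_num
    · simp; norm_num
  · rw [LieSubalgebra.coe_incl, coe_basisAB_one, MulOpposite.unop_op, opB_apply]
    ext i
    fin_cases i <;> simp
  · rw [hf0, coe_basisAB_zero, MulOpposite.unop_op]
    refine norm_opA_le.trans_lt ?_
    norm_num

end Example

end LieSpectrum

theorem proposition6 :
    -- nilpotent Lie algebras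
    (∀ (L : Type*) [LieRing L] [LieAlgebra ℂ L] [FiniteDimensional ℂ L] [LieRing.IsNilpotent L]
      (E : Type*) [NormedAddCommGroup E] [NormedSpace ℂ E] [CompleteSpace E]
      (ρ : L →ₗ⁅ℂ⁆ (E →L[ℂ] E)ᵐᵒᵖ),
      LieSpectrum.Sp ρ ⊆ {f : Module.Dual ℂ L | ∀ x : L, ‖f x‖ ≤ ‖(ρ x).unop‖}) ∧
    -- failure for a solvable Lie algebra that is not nilpotent
    (∃ L : LieSubalgebra ℂ (EuclideanSpace ℂ (Fin 2) →L[ℂ] EuclideanSpace ℂ (Fin 2))ᵐᵒᵖ,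
      L.toSubmodule =
        Submodule.span ℂ {MulOpposite.op LieSpectrum.opA, MulOpposite.op LieSpectrum.opB} ∧
      LieAlgebra.IsSolvable L ∧ ¬ LieRing.IsNilpotent L ∧
      ∃ f ∈ LieSpectrum.Sp L.incl, ∃ x : L, ‖(x : (EuclideanSpace ℂ (Fin 2) →L[ℂ]
        EuclideanSpace ℂ (Fin 2))ᵐᵒᵖ).unop‖ < ‖f x‖) := by
  refine ⟨?_, LieSpectrum.spanAB, rfl, LieSpectrum.isSolvable_of_basis _ LieSpectrum.lie_basisAB,
    LieSpectrum.not_isNilpotent_of_basis _ LieSpectrum.lie_basisAB,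
    LieSpectrum.exists_mem_Sp_norm_lt⟩
  intro L _ _ _ _ E _ _ _ ρ f hf x
  exact LieSpectrum.norm_le_of_mem_Sp ρ (LieModule.isNilpotent_toEnd_of_isNilpotent ℂ L L x) hf
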